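/- Let $G$ be a connected simple graph with $n\ge 4$ vertices and $m$ edges, and let $r\ge 1$ be an integer such that $G$ has exactly $p\ge 1$ vertices of degree $r$. Let $\mu_1\ge\mu_2\ge\dots\ge\mu_n$ be the eigenvalues, with multiplicity, of the Laplacian matrix $L(G)=D(G)-A(G)$ (where $D(G)$ is the diagonal matrix of vertex degrees and $A(G)$ the adjacency matrix), and put $S_k(G)=\sum_{i=1}^k\mu_i$. For an integer $k$ with $1\le k\le n$, say that Brouwer's conjecture holds for $k$ if $S_k(G)\le m+\binom{k+1}{2}$. Then: (i) If $m\ge\frac{(2n-r-1)r}{2}$, then Brouwer's conjecture holds for every integer $k\in[1,r]$. (ii) If $p<\frac n2$ and $m\ge\frac{(n-1)(3n-1)}{8}-\frac{(n-1-2r)p}{2}$, then Brouwer's conjecture holds for every integer $k\in[r+1,\frac{n-1}{2}]$. (iii) If $p>\frac n2$ and $m\ge\frac{(n-1)(3n-1)}{8}-\frac{(n-1-2r)p}{2}$, then Brouwer's conjecture holds for every integer $k\in[\frac{n-1}{2},n]$. -/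

import Mathlib

namespace SimpleGraph

/-- The sum `S_k(G)` of the `k` largest eigenvalues, counted with multiplicity, of the Laplacian
matrix `L(G) = D(G) - A(G)`. Mathlib's `eigenvalues₀` lists the eigenvalues in decreasing order,
indexed by `0, …, n - 1`. -/
noncomputable def laplacianSum {V : Type*} [Fintype V] [DecidableEq V] (G : SimpleGraph V)
    [DecidableRel G.Adj] (k : ℕ) : ℝ :=
  ∑ i : Fin (Fintype.card V) with i.val < k, (G.isHermitian_lapMatrix ℝ).eigenvalues₀ i

/-- Brouwer's conjecture holds for the graph `G` and the integer `k`: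
`S_k(G) ≤ m + (k + 1 choose 2)`, where `m` is the number of edges of `G`. -/
def BrouwerHolds {V : Type*} [Fintype V] [DecidableEq V] (G : SimpleGraph V)
    [DecidableRel G.Adj] (k : ℕ) : Prop :=
  G.laplacianSum k ≤ (G.edgeFinset.card : ℝ) + ((k + 1).choose 2 : ℝ)

end SimpleGraph

open Matrix

/-! All three ranges follow from two estimates, S_k ≤ kn and S_k ≤ kn - (k - r)p, by comparing
quadratics in k. The second is `laplacianSum_le_of_partition` applied to the vertices of degree r.

For that bound, let P be the chosen vertex set and Q its complement. The edges inside Q are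
dominated by a clique, and those inside P contribute at most the trace of their Laplacian. There
remains H = L - |Q|·1, with L the Laplacian of a split graph (clique Q, independent P, cross weights
b). The claim is that the sum of the form of H over any orthonormal family is at most the total
cross weight (`sum_shiftedLap_form_le`). By continuity, 0 < b < 1 may be assumed.

H is negative definite on ℝ^P. If it has at least |Q| nonnegative eigenvalues, their eigenvectors
therefore span a graph {(u, Xu)} over ℝ^Q. The trace of H on it, computed in the coordinate u, is
Σ_j (Σ_i b_ji - 1 - Σ_m b_jm X_mj). The all-ones vector is an eigenvector for -|Q|, hence orthogonal
to the graph, so the columns of X sum to -1. If moreover X ≤ 0 entrywise, then b < 1 makes the trace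
at most Σ b.

The sign of X (`IsNonnegGraph.nonpos`) comes from deforming b to a constant, where X is explicit:
the Riccati equation for X shows that X ≤ 0 forces X < 0, so the sign cannot be lost along the way.
If H has fewer than |Q| nonnegative eigenvalues, the complementary split graph, with P as the
clique, satisfies the hypothesis, and its majorant is carried back (`HasMajorant.of_compl`). -/

/-- The real spectral theorem in coordinates. -/
theorem Matrix.IsSymm.exists_diagonalization {n : Type*} [Fintype n] [DecidableEq n]
    {H : Matrix n n ℝ} (hH : H.IsSymm) :
    ∃ (V : Matrix n n ℝ) (l : n → ℝ), V * Vᵀ = 1 ∧ Vᵀ * V = 1 ∧ H * V = V * diagonal l := by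
  have hA : H.IsHermitian := by
    rw [IsHermitian, conjTranspose_eq_transpose_of_trivial]; exact hH
  refine ⟨hA.eigenvectorUnitary, hA.eigenvalues, ?_, ?_, ?_⟩
  · have := Unitary.coe_mul_star_self hA.eigenvectorUnitary
    rwa [Unitary.coe_star, star_eq_conjTranspose, conjTranspose_eq_transpose_of_trivial] at this
  · have := Unitary.coe_star_mul_self hA.eigenvectorUnitary
    rwa [star_eq_conjTranspose, conjTranspose_eq_transpose_of_trivial] at this
  · ext i j
    have := congrFun (hA.mulVec_eigenvectorBasis j) i
    rw [mul_diagonal, mul_comm, mul_apply]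
    simpa [mulVec, dotProduct] using this

namespace SplitLaplacian

variable {n Q P : Type*} [Fintype n] [DecidableEq n] [Fintype Q] [DecidableEq Q] [Fintype P]
  [DecidableEq P]

/-! ### Quadratic forms in eigenbasis coordinates. -/

omit [DecidableEq n] [DecidableEq Q] in
theorem mulVec_dotProduct (A : Matrix n Q ℝ) (z : Q → ℝ) (w : n → ℝ) :
    (A *ᵥ z) ⬝ᵥ w = z ⬝ᵥ (Aᵀ *ᵥ w) := by
  rw [dotProduct_mulVec, vecMul_transpose]

theorem mulVec_coords {V : Matrix n n ℝ} (h : V * Vᵀ = 1) (w : n → ℝ) : V *ᵥ (Vᵀ *ᵥ w) = w := by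
  rw [mulVec_mulVec, h, one_mulVec]

theorem coords_mulVec {H V : Matrix n n ℝ} {l : n → ℝ} (h : Vᵀ * V = 1) (h1 : V * Vᵀ = 1)
    (hV : H * V = V * diagonal l) (w : n → ℝ) (i : n) :
    (Vᵀ *ᵥ (H *ᵥ w)) i = l i * (Vᵀ *ᵥ w) i := by
  conv_lhs => rw [← mulVec_coords h1 w]
  rw [mulVec_mulVec _ H V, hV, ← mulVec_mulVec _ V, mulVec_mulVec _ Vᵀ V, h, one_mulVec,
    mulVec_diagonal]

theorem form_eq_coords {H V : Matrix n n ℝ} {l : n → ℝ} (h : Vᵀ * V = 1) (h1 : V * Vᵀ = 1)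
    (hV : H * V = V * diagonal l) (w : n → ℝ) :
    w ⬝ᵥ (H *ᵥ w) = ∑ i, l i * (Vᵀ *ᵥ w) i ^ 2 := by
  conv_lhs => enter [1]; rw [← mulVec_coords h1 w]
  rw [← vecMul_transpose, ← dotProduct_mulVec]
  simp only [dotProduct]
  refine Finset.sum_congr rfl fun i _ => ?_
  rw [coords_mulVec h h1 hV]; ring

/-! ### Nonnegative spectral subspaces as graphs over ℝ^Q. -/

/-- The matrix with columns `(u, X u)` parametrizing the graph of `X`. -/
def graphMatrix (X : Matrix P Q ℝ) : Matrix (Q ⊕ P) Q ℝ := fromRows 1 X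

omit [Fintype P] [DecidableEq P] in
theorem graphMatrix_mulVec (X : Matrix P Q ℝ) (u : Q → ℝ) :
    graphMatrix X *ᵥ u = Sum.elim u (X *ᵥ u) := by
  rw [graphMatrix, fromRows_mulVec, one_mulVec]

/-- The graph of `X` is invariant under `H`, and `H` is nonnegative on it. -/
structure IsNonnegGraph (H : Matrix (Q ⊕ P) (Q ⊕ P) ℝ) (X : Matrix P Q ℝ) : Prop where
  invariant : H * graphMatrix X = graphMatrix X * (H * graphMatrix X).toRows₁
  nonneg : ∀ u, 0 ≤ (graphMatrix X *ᵥ u) ⬝ᵥ (H *ᵥ (graphMatrix X *ᵥ u))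

/-- The orthogonal projection of an eigenvector to an invariant subspace satisfies the same
eigenvalue equation; a negative eigenvalue then contradicts nonnegativity unless the projection
vanishes. -/
theorem IsNonnegGraph.orthogonal {H : Matrix (Q ⊕ P) (Q ⊕ P) ℝ} (hH : H.IsSymm)
    {X : Matrix P Q ℝ} (hX : IsNonnegGraph H X) {w : Q ⊕ P → ℝ} {l : ℝ} (hw : H *ᵥ w = l • w)
    (hl : l < 0) : (graphMatrix X)ᵀ *ᵥ w = 0 := by
  set U := graphMatrix X with hU
  set K := (H * U).toRows₁ with hK
  have inj : ∀ z, U *ᵥ z = 0 → z = 0 := by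
    intro z hz
    ext j
    have := congrFun hz (Sum.inl j)
    rw [hU, graphMatrix_mulVec] at this
    simpa using this
  have hinj : Function.Injective (Uᵀ * U).mulVecLin := by
    rw [injective_iff_map_eq_zero]
    intro z hz
    apply inj
    rw [mulVecLin_apply] at hz
    apply dotProduct_self_eq_zero.1
    rw [mulVec_dotProduct, mulVec_mulVec, hz, dotProduct_zero]
  -- The normal equations: `U *ᵥ z` is the projection of `w` to the graph.
  obtain ⟨z, hz⟩ := (LinearMap.injective_iff_surjective.1 hinj) (Uᵀ *ᵥ w)
  rw [mulVecLin_apply] at hz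
  have hinv := hX.invariant
  have e1 : (U *ᵥ z) ⬝ᵥ (H *ᵥ (U *ᵥ z)) = l * ((U *ᵥ z) ⬝ᵥ (U *ᵥ z)) := by
    have a1 : (U *ᵥ z) ⬝ᵥ (H *ᵥ (U *ᵥ z)) = (K *ᵥ z) ⬝ᵥ (Uᵀ *ᵥ (U *ᵥ z)) := by
      rw [mulVec_mulVec, hinv, ← mulVec_mulVec, dotProduct_comm, mulVec_dotProduct]
    rw [a1, mulVec_mulVec, hz, ← mulVec_dotProduct, mulVec_mulVec, ← hinv, ← mulVec_mulVec,
      mulVec_dotProduct, hH.eq, hw, dotProduct_smul, smul_eq_mul, mulVec_dotProduct, ← hz,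
      ← mulVec_mulVec, ← mulVec_dotProduct]
  have e2 := hX.nonneg z
  rw [← hU, e1] at e2
  have e3 : 0 ≤ (U *ᵥ z) ⬝ᵥ (U *ᵥ z) := Finset.sum_nonneg fun i _ => mul_self_nonneg _
  have e4 : (U *ᵥ z) ⬝ᵥ (U *ᵥ z) = 0 := by nlinarith
  rw [← hz, inj z (dotProduct_self_eq_zero.1 e4), mulVec_zero]

/-- A subspace of full dimension on which `H` is nonnegative is a graph if `H` is negative
on the second summand. -/
theorem exists_graph_of_subspace {H : Matrix (Q ⊕ P) (Q ⊕ P) ℝ}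
    (hneg : ∀ v : P → ℝ, v ≠ 0 → Sum.elim 0 v ⬝ᵥ (H *ᵥ Sum.elim 0 v) < 0)
    (S : Submodule ℝ (Q ⊕ P → ℝ)) (hS : Fintype.card Q ≤ Module.finrank ℝ S)
    (hpos : ∀ w ∈ S, 0 ≤ w ⬝ᵥ (H *ᵥ w)) :
    ∃ X : Matrix P Q ℝ, ∀ u, graphMatrix X *ᵥ u ∈ S := by
  let f : S →ₗ[ℝ] (Q → ℝ) := (LinearMap.funLeft ℝ ℝ (Sum.inl : Q → Q ⊕ P)).comp S.subtype
  have hf : Function.Injective f := by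
    rw [injective_iff_map_eq_zero]
    intro ⟨w, hw⟩ h0
    have h1 : w = Sum.elim (0 : Q → ℝ) (w ∘ Sum.inr) := by
      ext x
      rcases x with j | i
      · exact congrFun h0 j
      · rfl
    by_contra hne
    have hne' : w ∘ Sum.inr ≠ 0 := by
      intro h
      apply hne
      ext x
      change w x = 0
      rw [h1, h]
      cases x <;> rfl
    have := hneg _ hne'
    rw [← h1] at this
    exact absurd (hpos w hw) (not_le.2 this)
  have hcard : Module.finrank ℝ S = Module.finrank ℝ (Q → ℝ) := by
    apply le_antisymm (LinearMap.finrank_le_finrank_of_injective hf)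
    simpa using hS
  let g := LinearEquiv.ofInjectiveOfFinrankEq f hf hcard
  let X : (Q → ℝ) →ₗ[ℝ] (P → ℝ) :=
    (LinearMap.funLeft ℝ ℝ (Sum.inr : P → Q ⊕ P)).comp (S.subtype.comp g.symm.toLinearMap)
  refine ⟨LinearMap.toMatrix' X, fun u => ?_⟩
  have : graphMatrix (LinearMap.toMatrix' X) *ᵥ u = (g.symm u : Q ⊕ P → ℝ) := by
    rw [graphMatrix_mulVec, LinearMap.toMatrix'_mulVec]
    ext x; rcases x with j | i
    · have := congrFun (g.apply_symm_apply u) j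
      exact this.symm
    · rfl
  rw [this]
  exact (g.symm u).2

/-- The spectral subspace of `H` for nonnegative eigenvalues is the unique invariant graph on
which `H` is nonnegative. -/
theorem exists_unique_nonnegGraph {H : Matrix (Q ⊕ P) (Q ⊕ P) ℝ} (hH : H.IsSymm)
    (hneg : ∀ v : P → ℝ, v ≠ 0 → Sum.elim 0 v ⬝ᵥ (H *ᵥ Sum.elim 0 v) < 0)
    (X₀ : Matrix P Q ℝ) (hX₀ : ∀ u, 0 ≤ (graphMatrix X₀ *ᵥ u) ⬝ᵥ (H *ᵥ (graphMatrix X₀ *ᵥ u))) :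
    ∃ X : Matrix P Q ℝ, IsNonnegGraph H X ∧ (∀ X', IsNonnegGraph H X' → X' = X) ∧
      ∀ w, (graphMatrix X)ᵀ *ᵥ w = 0 → w ⬝ᵥ (H *ᵥ w) ≤ 0 := by
  obtain ⟨V, l, h1, h2, hV⟩ := hH.exists_diagonalization
  let F : (Q ⊕ P → ℝ) →ₗ[ℝ] ({i // l i < 0} → ℝ) :=
    (LinearMap.funLeft ℝ ℝ Subtype.val).comp Vᵀ.mulVecLin
  have hF : ∀ w (i : {i // l i < 0}), F w i = (Vᵀ *ᵥ w) i := fun _ _ => rfl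
  have hform := form_eq_coords h2 h1 hV
  have hpos : ∀ w ∈ LinearMap.ker F, 0 ≤ w ⬝ᵥ (H *ᵥ w) := by
    intro w hw
    rw [hform]
    refine Finset.sum_nonneg fun i _ => ?_
    by_cases hi : l i < 0
    · have : (Vᵀ *ᵥ w) i = 0 := congrFun (LinearMap.mem_ker.1 hw) ⟨i, hi⟩
      rw [this]; simp
    · exact mul_nonneg (not_lt.1 hi) (sq_nonneg _)
  -- The graph of `X₀` injects into the coordinates with nonnegative eigenvalue: if these all
  -- vanish, the form is a sum of nonpositive terms, and its nonnegativity kills the rest.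
  have hcard : Fintype.card Q ≤ Fintype.card {i // ¬ l i < 0} := by
    let E : (Q → ℝ) →ₗ[ℝ] ({i // ¬ l i < 0} → ℝ) :=
      (LinearMap.funLeft ℝ ℝ Subtype.val).comp (Vᵀ.mulVecLin.comp (graphMatrix X₀).mulVecLin)
    have hE : Function.Injective E := by
      rw [injective_iff_map_eq_zero]
      intro u hu
      have hz : ∀ i, ¬ l i < 0 → (Vᵀ *ᵥ (graphMatrix X₀ *ᵥ u)) i = 0 :=
        fun i hi => congrFun hu ⟨i, hi⟩
      have hnp : ∀ i ∈ Finset.univ, l i * (Vᵀ *ᵥ (graphMatrix X₀ *ᵥ u)) i ^ 2 ≤ 0 := by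
        intro i _
        by_cases hi : l i < 0
        · exact mul_nonpos_of_nonpos_of_nonneg hi.le (sq_nonneg _)
        · rw [hz i hi]; simp
      have hsum := hX₀ u
      rw [hform] at hsum
      have hall := (Finset.sum_eq_zero_iff_of_nonpos hnp).1
        (le_antisymm (Finset.sum_nonpos hnp) hsum)
      have hc : Vᵀ *ᵥ (graphMatrix X₀ *ᵥ u) = 0 := by
        ext i
        by_cases hi : l i < 0
        · have := hall i (Finset.mem_univ i)
          rcases mul_eq_zero.1 this with h | h
          · exact absurd h hi.ne
          · exact pow_eq_zero_iff (two_ne_zero) |>.1 h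
        · exact hz i hi
      have hw : graphMatrix X₀ *ᵥ u = 0 := by rw [← mulVec_coords h1 (graphMatrix X₀ *ᵥ u), hc,
        mulVec_zero]
      ext j
      have := congrFun hw (Sum.inl j)
      rw [graphMatrix_mulVec] at this
      simpa using this
    simpa using LinearMap.finrank_le_finrank_of_injective hE
  have hcompl : Fintype.card {i // l i < 0} + Fintype.card {i // ¬ l i < 0} =
      Fintype.card Q + Fintype.card P := by
    rw [Fintype.card_subtype_compl, ← Fintype.card_sum]
    exact Nat.add_sub_cancel' (Fintype.card_subtype_le _)
  have hrank : Fintype.card Q ≤ Module.finrank ℝ (LinearMap.ker F) := by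
    have a := LinearMap.finrank_range_add_finrank_ker F
    have b := Submodule.finrank_le (LinearMap.range F)
    simp only [Module.finrank_fintype_fun_eq_card, Fintype.card_sum] at a b
    omega
  obtain ⟨X, hX⟩ := exists_graph_of_subspace hneg (LinearMap.ker F) hrank hpos
  have hmem : ∀ w ∈ LinearMap.ker F, w = graphMatrix X *ᵥ (w ∘ Sum.inl) := by
    intro w hw
    -- The difference lies both in `ker F` and in 0 ⊕ ℝ^P, where the form has opposite signs.
    have hd := (LinearMap.ker F).sub_mem hw (hX (w ∘ Sum.inl))
    have he : w - graphMatrix X *ᵥ (w ∘ Sum.inl) =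
        Sum.elim (0 : Q → ℝ) (w ∘ Sum.inr - X *ᵥ (w ∘ Sum.inl)) := by
      rw [graphMatrix_mulVec]
      ext x; rcases x with j | i <;> simp
    by_contra hne
    have h0 : w ∘ Sum.inr - X *ᵥ (w ∘ Sum.inl) ≠ 0 := by
      intro h
      apply hne
      rw [h] at he
      rw [← sub_eq_zero, he]
      ext x; rcases x with j | i <;> rfl
    have := hneg _ h0
    rw [← he] at this
    exact absurd (hpos _ hd) (not_le.2 this)
  refine ⟨X, ⟨?_, fun u => hpos _ (hX u)⟩, ?_, ?_⟩
  · apply ext_of_mulVec_single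
    intro j
    have hk : H *ᵥ (graphMatrix X *ᵥ Pi.single j 1) ∈ LinearMap.ker F := by
      rw [LinearMap.mem_ker]
      ext i
      rw [hF, coords_mulVec h2 h1 hV, ← hF, LinearMap.mem_ker.1 (hX _)]
      simp
    rw [← mulVec_mulVec, ← mulVec_mulVec]
    refine (hmem _ hk).trans (congrArg _ ?_)
    rw [mulVec_mulVec]
    rfl
  · intro X' hX'
    have key : ∀ u, graphMatrix X' *ᵥ u ∈ LinearMap.ker F := by
      intro u
      rw [LinearMap.mem_ker]
      ext i
      have hcol : H *ᵥ V.col i = l i • V.col i := by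
        ext x
        have := congrFun (congrFun hV x) i
        rw [mul_diagonal] at this
        rw [Pi.smul_apply, smul_eq_mul, mul_comm, col_apply, ← this]
        rfl
      have ho := hX'.orthogonal hH hcol i.2
      have : (Vᵀ *ᵥ (graphMatrix X' *ᵥ u)) i = V.col i ⬝ᵥ (graphMatrix X' *ᵥ u) := rfl
      rw [hF, this, dotProduct_mulVec, ← mulVec_transpose, ho]
      simp
    apply ext_of_mulVec_single
    intro j
    have := hmem _ (key (Pi.single j 1))
    rw [graphMatrix_mulVec, Sum.elim_comp_inl, graphMatrix_mulVec] at this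
    ext i
    exact congrFun this (Sum.inr i)
  · intro w hw
    rw [hform]
    refine Finset.sum_nonpos fun i _ => ?_
    by_cases hi : l i < 0
    · exact mul_nonpos_of_nonpos_of_nonneg hi.le (sq_nonneg _)
    · have hk : V.col i ∈ LinearMap.ker F := by
        rw [LinearMap.mem_ker]
        ext i'
        have hne : (i' : Q ⊕ P) ≠ i := fun h => hi (h ▸ i'.2)
        have := congrFun (congrFun h2 i') i
        rw [one_apply_ne hne] at this
        exact this
      have : (Vᵀ *ᵥ w) i = V.col i ⬝ᵥ w := rfl
      rw [this, hmem _ hk, dotProduct_comm, dotProduct_mulVec, ← mulVec_transpose, hw]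
      simp


/-! ### The shifted Laplacian of a weighted split graph. -/

/-- `L - |Q| • 1`, where `L` is the Laplacian of the weighted split graph in which `Q` is a clique,
`P` is independent and the cross weights are `b`. -/
def shiftedLap (b : Matrix Q P ℝ) : Matrix (Q ⊕ P) (Q ⊕ P) ℝ :=
  fromBlocks (diagonal (fun j => ∑ i, b j i) - of fun _ _ => 1) (-b) (-bᵀ)
    (diagonal fun i => ∑ j, b j i - Fintype.card Q)

theorem isSymm_shiftedLap (b : Matrix Q P ℝ) : (shiftedLap b).IsSymm := by
  unfold shiftedLap
  refine IsSymm.fromBlocks ?_ (by simp) ?_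
  · refine (isSymm_diagonal _).sub ?_
    ext i j; rfl
  · exact isSymm_diagonal _

theorem shiftedLap_mulVec (b : Matrix Q P ℝ) (y : Q → ℝ) (z : P → ℝ) :
    shiftedLap b *ᵥ Sum.elim y z =
      Sum.elim (fun j => (∑ i, b j i) * y j - ∑ l, y l - ∑ i, b j i * z i)
        (fun i => (∑ j, b j i - Fintype.card Q) * z i - ∑ j, b j i * y j) := by
  unfold shiftedLap
  rw [fromBlocks_mulVec]
  ext x
  rcases x with j | i
  · simp only [Sum.elim_comp_inl, Sum.elim_comp_inr, Sum.elim_inl, Pi.add_apply, sub_mulVec,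
      Pi.sub_apply, mulVec_diagonal, neg_mulVec, Pi.neg_apply]
    simp [mulVec, dotProduct]
    ring
  · simp only [Sum.elim_comp_inl, Sum.elim_comp_inr, Sum.elim_inr, Pi.add_apply,
      mulVec_diagonal, neg_mulVec, Pi.neg_apply]
    simp [mulVec, dotProduct]
    ring

theorem shiftedLap_form (b : Matrix Q P ℝ) (y : Q → ℝ) (z : P → ℝ) :
    Sum.elim y z ⬝ᵥ (shiftedLap b *ᵥ Sum.elim y z) =
      ∑ j, ∑ i, b j i * (y j - z i) ^ 2 - (∑ j, y j) ^ 2 - Fintype.card Q * ∑ i, z i ^ 2 := by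
  rw [shiftedLap_mulVec, sumElim_dotProduct_sumElim]
  simp only [dotProduct]
  have e1 : ∑ j, ∑ i, b j i * (y j - z i) ^ 2 =
      ∑ j, (∑ i, b j i) * y j ^ 2 - 2 * ∑ j, y j * ∑ i, b j i * z i
        + ∑ i, (∑ j, b j i) * z i ^ 2 := by
    have : ∑ i, (∑ j, b j i) * z i ^ 2 = ∑ j, ∑ i, b j i * z i ^ 2 := by
      rw [Finset.sum_comm]
      exact Finset.sum_congr rfl fun i _ => Finset.sum_mul _ _ _
    rw [this, Finset.mul_sum, ← Finset.sum_sub_distrib, ← Finset.sum_add_distrib]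
    refine Finset.sum_congr rfl fun j _ => ?_
    rw [Finset.sum_mul, Finset.mul_sum, Finset.mul_sum, ← Finset.sum_sub_distrib,
      ← Finset.sum_add_distrib]
    refine Finset.sum_congr rfl fun i _ => ?_
    ring
  have e2 : ∑ j, y j * ((∑ i, b j i) * y j - ∑ l, y l - ∑ i, b j i * z i) =
      ∑ j, (∑ i, b j i) * y j ^ 2 - (∑ j, y j) ^ 2 - ∑ j, y j * ∑ i, b j i * z i := by
    rw [sq, Finset.sum_mul, ← Finset.sum_sub_distrib, ← Finset.sum_sub_distrib]
    exact Finset.sum_congr rfl fun j _ => by ring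
  have e3 : ∑ i, z i * ((∑ j, b j i - Fintype.card Q) * z i - ∑ j, b j i * y j) =
      ∑ i, (∑ j, b j i) * z i ^ 2 - Fintype.card Q * ∑ i, z i ^ 2
        - ∑ j, y j * ∑ i, b j i * z i := by
    have : ∑ j, y j * ∑ i, b j i * z i = ∑ i, z i * ∑ j, b j i * y j := by
      simp_rw [Finset.mul_sum]
      rw [Finset.sum_comm]
      exact Finset.sum_congr rfl fun i _ => Finset.sum_congr rfl fun j _ => by ring
    rw [this, Finset.mul_sum, ← Finset.sum_sub_distrib, ← Finset.sum_sub_distrib]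
    exact Finset.sum_congr rfl fun j _ => by ring
  rw [e1, e2, e3]; ring

theorem shiftedLap_neg [Nonempty Q] {b : Matrix Q P ℝ} (hb : ∀ j i, b j i < 1) (v : P → ℝ)
    (hv : v ≠ 0) :
    Sum.elim 0 v ⬝ᵥ (shiftedLap b *ᵥ Sum.elim 0 v) < 0 := by
  rw [shiftedLap_form, Finset.sum_comm]
  have : ∑ i, ∑ j, b j i * ((0 : Q → ℝ) j - v i) ^ 2 < ∑ i, Fintype.card Q * v i ^ 2 := by
    obtain ⟨i₀, hi₀⟩ := Function.ne_iff.1 hv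
    have hle : ∀ i j, b j i * ((0 : Q → ℝ) j - v i) ^ 2 ≤ v i ^ 2 := by
      intro i j
      have := hb j i
      simp only [Pi.zero_apply, zero_sub, neg_sq]
      nlinarith [sq_nonneg (v i)]
    have hc : ∀ i, (Fintype.card Q : ℝ) * v i ^ 2 = ∑ _j : Q, v i ^ 2 := by simp
    simp_rw [hc]
    refine Finset.sum_lt_sum (fun i _ => Finset.sum_le_sum fun j _ => hle i j)
      ⟨i₀, Finset.mem_univ _, ?_⟩
    refine Finset.sum_lt_sum_of_nonempty Finset.univ_nonempty fun j _ => ?_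
    have h1 := hb j i₀
    have h2 : 0 < v i₀ ^ 2 := by
      have : v i₀ ≠ 0 := hi₀
      positivity
    simp only [Pi.zero_apply, zero_sub, neg_sq]
    nlinarith
  rw [← Finset.mul_sum] at this
  simp only [Pi.zero_apply, Finset.sum_const_zero] at this ⊢
  linarith

theorem shiftedLap_mulVec_one (b : Matrix Q P ℝ) :
    shiftedLap b *ᵥ 1 = (-(Fintype.card Q : ℝ)) • 1 := by
  have : (1 : Q ⊕ P → ℝ) = Sum.elim (1 : Q → ℝ) (1 : P → ℝ) := by
    ext x; rcases x with j | i <;> rfl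
  rw [this, shiftedLap_mulVec]
  ext x; rcases x with j | i <;> simp

/-- The graph is orthogonal to the all-ones vector, whose eigenvalue -|Q| is negative. -/
theorem IsNonnegGraph.sum_col [Nonempty Q] {b : Matrix Q P ℝ} {X : Matrix P Q ℝ}
    (hX : IsNonnegGraph (shiftedLap b) X) (j : Q) : ∑ i, X i j = -1 := by
  have h := hX.orthogonal (isSymm_shiftedLap b) (shiftedLap_mulVec_one b)
    (by simp [Fintype.card_pos])
  have := congrFun h j
  simp only [graphMatrix, mulVec, dotProduct, Fintype.sum_sum_type, transpose_apply,
    fromRows_apply_inl, fromRows_apply_inr, Pi.one_apply, mul_one, Pi.zero_apply] at this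
  simp only [one_apply, Finset.sum_ite_eq', Finset.mem_univ, if_true] at this
  linarith

theorem shiftedLap_mul_graphMatrix_inl (b : Matrix Q P ℝ) (X : Matrix P Q ℝ) (l j : Q) :
    (shiftedLap b * graphMatrix X) (Sum.inl l) j =
      (if l = j then ∑ i, b l i else 0) - 1 - ∑ m, b l m * X m j := by
  have := congrFun (shiftedLap_mulVec b (Pi.single j 1) (fun i => X i j)) (Sum.inl l)
  have hs : Sum.elim (Pi.single j 1) (fun i => X i j) = graphMatrix X *ᵥ Pi.single j (1 : ℝ) := by
    rw [graphMatrix_mulVec, mulVec_single_one]; rfl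
  rw [hs, mulVec_mulVec, mulVec_single_one, Sum.elim_inl] at this
  rw [← col_apply (shiftedLap b * graphMatrix X), this]
  simp [Pi.single_apply]

theorem shiftedLap_mul_graphMatrix_inr (b : Matrix Q P ℝ) (X : Matrix P Q ℝ) (i : P) (j : Q) :
    (shiftedLap b * graphMatrix X) (Sum.inr i) j =
      (∑ l, b l i - Fintype.card Q) * X i j - b j i := by
  have := congrFun (shiftedLap_mulVec b (Pi.single j 1) (fun i => X i j)) (Sum.inr i)
  have hs : Sum.elim (Pi.single j 1) (fun i => X i j) = graphMatrix X *ᵥ Pi.single j (1 : ℝ) := by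
    rw [graphMatrix_mulVec, mulVec_single_one]; rfl
  rw [hs, mulVec_mulVec, mulVec_single_one, Sum.elim_inr] at this
  rw [← col_apply (shiftedLap b * graphMatrix X), this]
  simp [Pi.single_apply]

/-- The algebraic Riccati equation satisfied by an invariant graph. -/
theorem IsNonnegGraph.riccati {b : Matrix Q P ℝ} {X : Matrix P Q ℝ}
    (hX : IsNonnegGraph (shiftedLap b) X) (i : P) (j : Q) :
    X i j * (Fintype.card Q + ∑ m, b j m - ∑ l, b l i) =
      -b j i + ∑ l, X i l * (1 + ∑ m, b l m * X m j) := by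
  have h := congrFun (congrFun hX.invariant (Sum.inr i)) j
  rw [shiftedLap_mul_graphMatrix_inr, mul_apply] at h
  have h1 : ∀ l, graphMatrix X (Sum.inr i) l = X i l := fun _ => rfl
  simp only [h1, toRows₁_apply] at h
  have h2 : ∀ l, X i l * (shiftedLap b * graphMatrix X) (Sum.inl l) j =
      (if l = j then X i j * ∑ m, b j m else 0) - X i l * (1 + ∑ m, b l m * X m j) := by
    intro l
    rw [shiftedLap_mul_graphMatrix_inl]
    split_ifs with hl
    · subst hl; ring
    · ring
  rw [Finset.sum_congr rfl fun l _ => h2 l, Finset.sum_sub_distrib] at h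
  simp only [Finset.sum_ite_eq', Finset.mem_univ, if_true] at h
  linarith

/-- In the Riccati equation the coefficient of `X i j` is positive, while the right side is at most
`-b j i < 0`, because the column sums -1 keep the factors `1 + ∑ m, b l m * X m j` nonnegative. This
strictness drives the deformation argument. -/
theorem IsNonnegGraph.neg_of_nonpos [Nonempty Q] {b : Matrix Q P ℝ}
    (hb : ∀ j i, 0 < b j i) (hb1 : ∀ j i, b j i < 1) {X : Matrix P Q ℝ}
    (hX : IsNonnegGraph (shiftedLap b) X) (h0 : ∀ i j, X i j ≤ 0) (i : P) (j : Q) :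
    X i j < 0 := by
  have hr := hX.riccati i j
  have hsum : ∑ l, X i l * (1 + ∑ m, b l m * X m j) ≤ 0 := by
    refine Finset.sum_nonpos fun l _ => mul_nonpos_of_nonpos_of_nonneg (h0 i l) ?_
    have : ∑ m, X m j ≤ ∑ m, b l m * X m j :=
      Finset.sum_le_sum fun m _ => by nlinarith [h0 m j, hb1 l m]
    rw [hX.sum_col] at this
    linarith
  have hpos : 0 < (Fintype.card Q : ℝ) + ∑ m, b j m - ∑ l, b l i := by
    have h1 : ∑ l, b l i < ∑ _l : Q, (1 : ℝ) :=
      Finset.sum_lt_sum_of_nonempty Finset.univ_nonempty fun l _ => hb1 l i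
    have h2 : 0 ≤ ∑ m, b j m := Finset.sum_nonneg fun m _ => (hb j m).le
    simp only [Finset.sum_const, Finset.card_univ, nsmul_eq_mul, mul_one] at h1
    linarith
  by_contra hcon
  have : 0 ≤ X i j * (Fintype.card Q + ∑ m, b j m - ∑ l, b l i) :=
    mul_nonneg (not_lt.1 hcon) hpos.le
  linarith [hb j i]

/-- An a priori bound on the entries of a nonnegative graph. -/
theorem IsNonnegGraph.abs_entry_le [Nonempty Q] {b : Matrix Q P ℝ} {β : ℝ} (hβ0 : 0 ≤ β) (hβ : β < 1)
    (hb : ∀ j i, b j i ≤ β) {X : Matrix P Q ℝ} (hX : IsNonnegGraph (shiftedLap b) X)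
    (i : P) (j : Q) :
    |X i j| ≤ 1 + (2 / (1 - β)) * (Fintype.card P + (Fintype.card P + 2) / (1 - β) + 1) := by
  set δ := 1 - β with hδ
  have hδ0 : 0 < δ := by rw [hδ]; linarith
  set p : ℝ := (Fintype.card P : ℝ) with hp
  set q : ℝ := (Fintype.card Q : ℝ) with hq
  have hq1 : 1 ≤ q := by
    rw [hq]; exact_mod_cast Fintype.card_pos
  -- Testing column `j` gives a nonnegative sum of concave quadratics in the entries, with leading
  -- coefficients at most -(1 - β). Each is bounded above, so none can be very negative. The
  -- resulting bound involves only β and |P|, hence is uniform along a deformation.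
  have h := hX.nonneg (Pi.single j 1)
  rw [graphMatrix_mulVec, mulVec_single_one, shiftedLap_form, Finset.sum_comm] at h
  simp only [col_apply] at h
  have hS : ∀ i, ∑ l, b l i * ((Pi.single j 1 : Q → ℝ) l - X i j) ^ 2 ≤
      β * (1 - 2 * X i j + q * X i j ^ 2) := by
    intro i
    calc _ ≤ ∑ l, β * ((Pi.single j 1 : Q → ℝ) l - X i j) ^ 2 :=
          Finset.sum_le_sum fun l _ => mul_le_mul_of_nonneg_right (hb l i) (sq_nonneg _)
      _ = β * ∑ l, ((if l = j then 1 - 2 * X i j else 0) + X i j ^ 2) := by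
          rw [← Finset.mul_sum]
          congr 1
          refine Finset.sum_congr rfl fun l _ => ?_
          rw [Pi.single_apply]
          split_ifs <;> ring
      _ = _ := by
          rw [Finset.sum_add_distrib]
          simp [hq]
  have h1 : 0 ≤ ∑ i, (β * (1 - 2 * X i j + q * X i j ^ 2) - q * X i j ^ 2) := by
    rw [Finset.sum_sub_distrib, ← Finset.mul_sum Finset.univ (fun i => X i j ^ 2)]
    have := Finset.sum_le_sum fun i (_ : i ∈ Finset.univ) => hS i
    nlinarith [sq_nonneg (∑ l, (Pi.single j 1 : Q → ℝ) l)]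
  have h2 : ∀ i, β * (1 - 2 * X i j + q * X i j ^ 2) - q * X i j ^ 2 ≤
      1 + 2 * |X i j| - δ * X i j ^ 2 := by
    intro i
    have a1 : -X i j ≤ |X i j| := neg_le_abs _
    have a2 : 0 ≤ |X i j| := abs_nonneg _
    have a3 : β * (-X i j) ≤ |X i j| := by nlinarith
    have a4 : δ * X i j ^ 2 ≤ δ * q * X i j ^ 2 := by
      have := mul_nonneg hδ0.le (sq_nonneg (X i j))
      nlinarith
    have : β = 1 - δ := by rw [hδ]; ring
    rw [this] at a3 ⊢
    nlinarith
  have h3 : ∀ i, 1 + 2 * |X i j| - δ * X i j ^ 2 ≤ 1 + 1 / δ := by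
    intro i
    have : 0 ≤ δ * (|X i j| - 1 / δ) ^ 2 := by positivity
    have e : δ * (|X i j| - 1 / δ) ^ 2 = δ * X i j ^ 2 - 2 * |X i j| + 1 / δ := by
      rw [sub_sq, sq_abs]; field_simp
    linarith
  have h4 : 0 ≤ (1 + 2 * |X i j| - δ * X i j ^ 2) + p * (1 + 1 / δ) := by
    calc 0 ≤ ∑ i, (1 + 2 * |X i j| - δ * X i j ^ 2) :=
          h1.trans (Finset.sum_le_sum fun i _ => h2 i)
      _ = (1 + 2 * |X i j| - δ * X i j ^ 2) +
          ∑ i ∈ Finset.univ.erase i, (1 + 2 * |X i j| - δ * X i j ^ 2) :=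
          (Finset.add_sum_erase _ _ (Finset.mem_univ i)).symm
      _ ≤ _ := by
          gcongr
          calc _ ≤ ∑ _i ∈ Finset.univ.erase i, (1 + 1 / δ) := Finset.sum_le_sum fun i _ => h3 i
            _ ≤ ∑ _i : P, (1 + 1 / δ) := Finset.sum_le_sum_of_subset_of_nonneg
                (Finset.subset_univ _) fun _ _ _ => by positivity
            _ = _ := by
                rw [Finset.sum_const, Finset.card_univ, nsmul_eq_mul]
  have h5 : δ * X i j ^ 2 / 2 ≤ p + (p + 2) / δ + 1 := by
    have : 0 ≤ δ / 2 * (|X i j| - 2 / δ) ^ 2 := by positivity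
    have e : δ / 2 * (|X i j| - 2 / δ) ^ 2 = δ * X i j ^ 2 / 2 - 2 * |X i j| + 2 / δ := by
      rw [sub_sq, sq_abs]; field_simp
    have e2 : (p + 2) / δ = p * (1 / δ) + 2 / δ := by ring
    rw [e2]
    linarith
  have h6 : X i j ^ 2 ≤ 2 / δ * (p + (p + 2) / δ + 1) := by
    rw [div_mul_eq_mul_div, le_div_iff₀ hδ0]
    linarith
  nlinarith [sq_abs (X i j), sq_nonneg (|X i j| - 1)]

/-! ### Deforming the weights to a constant: the sign of X. -/

theorem shiftedLap_form_mono {b c : Matrix Q P ℝ} (h : ∀ j i, b j i ≤ c j i) (w : Q ⊕ P → ℝ) :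
    w ⬝ᵥ (shiftedLap b *ᵥ w) ≤ w ⬝ᵥ (shiftedLap c *ᵥ w) := by
  rw [← Sum.elim_comp_inl_inr w, shiftedLap_form, shiftedLap_form]
  gcongr with j _ i _
  exact h j i

/-- The endpoint of the deformation. The condition on β is that the eigenvalue β(|Q| + |P|) of the
unshifted Laplacian, at the vector of the graph constant on Q and on P, is at least |Q|. -/
theorem isNonnegGraph_const [Nonempty Q] [Nonempty P] {β : ℝ} (hβ0 : 0 ≤ β)
    (hβ : (Fintype.card Q : ℝ) ≤ β * (Fintype.card Q + Fintype.card P)) :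
    IsNonnegGraph (shiftedLap (of fun (_ : Q) (_ : P) => β))
      (of fun _ _ => -(Fintype.card P : ℝ)⁻¹) := by
  have hp : (0 : ℝ) < Fintype.card P := by exact_mod_cast Fintype.card_pos
  have hq : (0 : ℝ) < Fintype.card Q := by exact_mod_cast Fintype.card_pos
  refine ⟨?_, fun u => ?_⟩
  · ext x j
    rcases x with l | i
    · conv_rhs => rw [graphMatrix, fromRows_mul, fromRows_apply_inl, Matrix.one_mul]
      rfl
    · rw [shiftedLap_mul_graphMatrix_inr, mul_apply]
      simp only [toRows₁_apply, shiftedLap_mul_graphMatrix_inl]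
      simp only [graphMatrix, fromRows_apply_inr, of_apply, ← Finset.mul_sum,
        Finset.sum_sub_distrib, Finset.sum_ite_eq', Finset.mem_univ, if_true, Finset.sum_const,
        Finset.card_univ, nsmul_eq_mul]
      field_simp
      ring
  · have hX : (of fun (_ : P) (_ : Q) => -(Fintype.card P : ℝ)⁻¹) *ᵥ u =
        fun _ => -(Fintype.card P : ℝ)⁻¹ * ∑ j, u j := by
      ext i; simp [mulVec, dotProduct, Finset.mul_sum]
    rw [graphMatrix_mulVec, hX, shiftedLap_form]
    set p : ℝ := (Fintype.card P : ℝ) with hpd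
    set q : ℝ := (Fintype.card Q : ℝ) with hqd
    set s := ∑ j, u j with hs
    have hcs : s ^ 2 ≤ q * ∑ j, u j ^ 2 := by
      rw [hs, hqd]
      exact sq_sum_le_card_mul_sum_sq
    have e1 : ∑ j, ∑ i : P, (of fun (_ : Q) (_ : P) => β) j i * (u j - -p⁻¹ * s) ^ 2 =
        β * (p * ∑ j, u j ^ 2 + 2 * s ^ 2 + q / p * s ^ 2) := by
      have : ∀ j, ∑ i : P, (of fun (_ : Q) (_ : P) => β) j i * (u j - -p⁻¹ * s) ^ 2 =
          β * p * u j ^ 2 + 2 * β * s * u j + β / p * s ^ 2 := by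
        intro j
        simp only [of_apply, Finset.sum_const, Finset.card_univ, nsmul_eq_mul, ← hpd]
        field_simp
        ring
      rw [Finset.sum_congr rfl fun j _ => this j, Finset.sum_add_distrib, Finset.sum_add_distrib,
        ← Finset.mul_sum, ← Finset.mul_sum, ← hs]
      simp only [Finset.sum_const, Finset.card_univ, nsmul_eq_mul, ← hqd]
      ring
    rw [e1]
    simp only [Finset.sum_const, Finset.card_univ, nsmul_eq_mul, ← hpd]
    have h1 : β * (p / q * s ^ 2) ≤ β * (p * ∑ j, u j ^ 2) := by
      apply mul_le_mul_of_nonneg_left _ hβ0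
      rw [div_mul_eq_mul_div, div_le_iff₀ hq]
      nlinarith
    have h2 : β * (p / q * s ^ 2) + β * (2 * s ^ 2 + q / p * s ^ 2) - s ^ 2 -
        q * (p * (-p⁻¹ * s) ^ 2) = (q + p) / (p * q) * (β * (q + p) - q) * s ^ 2 := by
      field_simp
      ring
    have h3 : 0 ≤ (q + p) / (p * q) * (β * (q + p) - q) * s ^ 2 := by
      have : 0 ≤ β * (q + p) - q := by linarith
      positivity
    linarith

theorem exists_const_bound {b : Matrix Q P ℝ} (hb : ∀ j i, b j i < 1) [Nonempty P] [Nonempty Q] :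
    ∃ β : ℝ, 0 < β ∧ β < 1 ∧ (∀ j i, b j i ≤ β) ∧
      (Fintype.card Q : ℝ) ≤ β * (Fintype.card Q + Fintype.card P) := by
  have hp : (0 : ℝ) < Fintype.card P := by exact_mod_cast Fintype.card_pos
  have hq : (0 : ℝ) < Fintype.card Q := by exact_mod_cast Fintype.card_pos
  let γ := (Fintype.card Q : ℝ) / (Fintype.card Q + Fintype.card P)
  have hγ0 : 0 < γ := by positivity
  have hγ1 : γ < 1 := by rw [div_lt_one (by positivity)]; linarith
  obtain ⟨x, -, hx⟩ := Finset.exists_max_image (Finset.univ : Finset (Q × P))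
    (fun x => b x.1 x.2) Finset.univ_nonempty
  refine ⟨max γ (b x.1 x.2), lt_max_of_lt_left hγ0, max_lt hγ1 (hb _ _),
    fun j i => le_max_of_le_right (hx (j, i) (Finset.mem_univ _)), ?_⟩
  calc (Fintype.card Q : ℝ) = γ * (Fintype.card Q + Fintype.card P) := by
        rw [div_mul_cancel₀]; positivity
    _ ≤ _ := by gcongr; exact le_max_left _ _

theorem continuous_shiftedLap : Continuous (shiftedLap : Matrix Q P ℝ → _) := by
  unfold shiftedLap
  refine Continuous.matrix_fromBlocks ?_ ?_ ?_ ?_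
  · refine Continuous.sub (Continuous.matrix_diagonal ?_) continuous_const
    fun_prop
  · fun_prop
  · fun_prop
  · refine Continuous.matrix_diagonal ?_
    fun_prop

theorem continuous_graphMatrix : Continuous (graphMatrix : Matrix P Q ℝ → _) := by
  refine continuous_matrix fun x j => ?_
  rcases x with l | i
  · exact continuous_const
  · exact continuous_id.matrix_elem i j

theorem isClosed_isNonnegGraph :
    IsClosed {x : Matrix (Q ⊕ P) (Q ⊕ P) ℝ × Matrix P Q ℝ | IsNonnegGraph x.1 x.2} := by
  have hU : Continuous fun x : Matrix (Q ⊕ P) (Q ⊕ P) ℝ × Matrix P Q ℝ => graphMatrix x.2 :=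
    continuous_graphMatrix.comp continuous_snd
  have hHU := continuous_fst.matrix_mul hU
  have : {x : Matrix (Q ⊕ P) (Q ⊕ P) ℝ × Matrix P Q ℝ | IsNonnegGraph x.1 x.2} =
      {x | x.1 * graphMatrix x.2 = graphMatrix x.2 * (x.1 * graphMatrix x.2).toRows₁} ∩
      ⋂ u, {x | 0 ≤ (graphMatrix x.2 *ᵥ u) ⬝ᵥ (x.1 *ᵥ (graphMatrix x.2 *ᵥ u))} := by
    ext x
    simp only [Set.mem_ofPred_eq, Set.mem_inter_iff, Set.mem_iInter]
    exact ⟨fun h => ⟨h.1, h.2⟩, fun h => ⟨h.1, h.2⟩⟩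
  rw [this]
  refine (isClosed_eq hHU (hU.matrix_mul ?_)).inter (isClosed_iInter fun u => ?_)
  · exact continuous_matrix fun i j => hHU.matrix_elem (Sum.inl i) j
  · have hv := hU.matrix_mulVec (continuous_const (y := u))
    exact isClosed_le continuous_const (hv.dotProduct (continuous_fst.matrix_mulVec hv))

/-- Entrywise sign of the graph of the top spectral subspace, by deforming the weights to
a constant. -/
theorem IsNonnegGraph.nonpos [Nonempty Q] [Nonempty P] {b : Matrix Q P ℝ}
    (hb : ∀ j i, 0 < b j i) (hb1 : ∀ j i, b j i < 1) {X : Matrix P Q ℝ}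
    (hX : IsNonnegGraph (shiftedLap b) X) (i : P) (j : Q) : X i j ≤ 0 := by
  obtain ⟨β, hβ0, hβ1, hbβ, hβ⟩ := exists_const_bound hb1
  let c : ℝ → Matrix Q P ℝ := fun s => of fun j i => (1 - s) * b j i + s * β
  have hc : Continuous c := continuous_matrix fun j i => by
    change Continuous fun s : ℝ => (1 - s) * b j i + s * β
    fun_prop
  have hc0 : c 0 = b := by ext; simp [c]
  have hc1 : c 1 = of fun _ _ => β := by ext; simp [c]
  have hcb : ∀ s ∈ Set.Icc (0 : ℝ) 1, ∀ j i, b j i ≤ c s j i ∧ c s j i ≤ β := by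
    intro s hs j i
    have := hbβ j i
    simp only [c, of_apply]
    constructor <;> nlinarith [hs.1, hs.2]
  have hpos : ∀ s ∈ Set.Icc (0 : ℝ) 1, ∀ j i, 0 < c s j i :=
    fun s hs j i => (hb j i).trans_le (hcb s hs j i).1
  have hlt : ∀ s ∈ Set.Icc (0 : ℝ) 1, ∀ j i, c s j i < 1 :=
    fun s hs j i => (hcb s hs j i).2.trans_lt hβ1
  -- The weights `c s` dominate `b`, so the graph of `X` itself witnesses that enough eigenvalues
  -- stay nonnegative.
  have hex : ∀ s ∈ Set.Icc (0 : ℝ) 1, ∃ Y, IsNonnegGraph (shiftedLap (c s)) Y ∧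
      ∀ Y', IsNonnegGraph (shiftedLap (c s)) Y' → Y' = Y := by
    intro s hs
    obtain ⟨Y, h1, h2, -⟩ := exists_unique_nonnegGraph (isSymm_shiftedLap (c s))
      (shiftedLap_neg (hlt s hs)) X fun u => (hX.nonneg u).trans
        (shiftedLap_form_mono (fun j i => (hcb s hs j i).1) _)
    exact ⟨Y, h1, h2⟩
  let C : ℝ := 1 + (2 / (1 - β)) * (Fintype.card P + (Fintype.card P + 2) / (1 - β) + 1)
  let G : Set (ℝ × Matrix P Q ℝ) := {x | IsNonnegGraph (shiftedLap (c x.1)) x.2}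
  have hG : IsClosed G := isClosed_isNonnegGraph.preimage
    (((continuous_shiftedLap.comp hc).comp continuous_fst).prodMk continuous_snd)
  let B : Set (ℝ × Matrix P Q ℝ) := Set.Icc (0 : ℝ) 1 ×ˢ
    (Set.univ.pi fun _ => Set.univ.pi fun _ => Set.Icc (-C) C)
  have hB : IsCompact B :=
    isCompact_Icc.prod (isCompact_univ_pi fun _ => isCompact_univ_pi fun _ => isCompact_Icc)
  have hmemB : ∀ s ∈ Set.Icc (0 : ℝ) 1, ∀ Y, IsNonnegGraph (shiftedLap (c s)) Y → (s, Y) ∈ B := by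
    intro s hs Y hY
    refine ⟨hs, fun i _ j _ => abs_le.1 ?_⟩
    exact hY.abs_entry_le hβ0.le hβ1 (fun j i => (hcb s hs j i).2) i j
  -- The projections of `N` and `M` to [0, 1] are closed by compactness and cover the interval. If
  -- both are nonempty, connectedness yields a common parameter, and uniqueness of the graph with
  -- `neg_of_nonpos` excludes one.
  let N : Set (ℝ × Matrix P Q ℝ) := {x | ∀ i j, x.2 i j ≤ 0}
  let M : Set (ℝ × Matrix P Q ℝ) := {x | ∃ i j, 0 ≤ x.2 i j}
  have hcont : ∀ (i : P) (j : Q), Continuous fun x : ℝ × Matrix P Q ℝ => x.2 i j :=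
    fun i j => continuous_snd.matrix_elem i j
  have hN : IsClosed N := by
    simp only [N, Set.ofPred_forall]
    exact isClosed_iInter fun i => isClosed_iInter fun j => isClosed_le (hcont i j) continuous_const
  have hM : IsClosed M := by
    simp only [M, Set.ofPred_exists]
    exact isClosed_iUnion_of_finite fun i => isClosed_iUnion_of_finite fun j =>
      isClosed_le continuous_const (hcont i j)
  have hclosed : ∀ T : Set (ℝ × Matrix P Q ℝ), IsClosed T →
      IsClosed (Prod.fst '' (B ∩ G ∩ T)) := fun T hT =>
    (((hB.inter_right hG).inter_right hT).image continuous_fst).isClosed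
  by_contra hcon
  have hpre := isPreconnected_closed_iff.1 (isPreconnected_Icc (a := (0 : ℝ)) (b := 1))
    _ _ (hclosed N hN) (hclosed M hM) ?_ ?_ ?_
  · obtain ⟨s, hs, ⟨⟨s1, Y⟩, ⟨⟨-, hY⟩, hYN⟩, rfl⟩, ⟨⟨s2, Z⟩, ⟨⟨-, hZ⟩, i', j', hZM⟩, rfl⟩⟩ := hpre
    obtain ⟨W, -, hW⟩ := hex _ hs
    have hYZ : Y = Z := (hW Y hY).trans (hW Z hZ).symm
    have := IsNonnegGraph.neg_of_nonpos (hpos _ hs) (hlt _ hs) hY hYN i' j'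
    rw [hYZ] at this
    exact absurd hZM (not_le.2 this)
  · intro s hs
    obtain ⟨Y, hY, -⟩ := hex s hs
    by_cases h : ∀ i j, Y i j ≤ 0
    · exact Or.inl ⟨(s, Y), ⟨⟨hmemB s hs Y hY, hY⟩, h⟩, rfl⟩
    · push Not at h
      obtain ⟨i', j', h⟩ := h
      exact Or.inr ⟨(s, Y), ⟨⟨hmemB s hs Y hY, hY⟩, i', j', h.le⟩, rfl⟩
  · have h1 : (1 : ℝ) ∈ Set.Icc (0 : ℝ) 1 := ⟨zero_le_one, le_rfl⟩
    have hY : IsNonnegGraph (shiftedLap (c 1)) (of fun (_ : P) (_ : Q) => -(Fintype.card P : ℝ)⁻¹) := by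
      rw [hc1]; exact isNonnegGraph_const hβ0.le hβ
    refine ⟨1, h1, ⟨(1, _), ⟨⟨hmemB 1 h1 _ hY, hY⟩, fun i j => ?_⟩, rfl⟩⟩
    simp
  · have h0 : (0 : ℝ) ∈ Set.Icc (0 : ℝ) 1 := ⟨le_rfl, zero_le_one⟩
    have hY : IsNonnegGraph (shiftedLap (c 0)) X := by rw [hc0]; exact hX
    exact ⟨0, h0, ⟨(0, X), ⟨⟨hmemB 0 h0 _ hY, hY⟩, i, j, (not_le.1 hcon).le⟩, rfl⟩⟩


/-! ### Majorants of small trace. -/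

/-- A nonnegative form dominating `shiftedLap b` whose trace is at most the total cross weight. -/
def HasMajorant (b : Matrix Q P ℝ) : Prop :=
  ∃ Z : Matrix (Q ⊕ P) (Q ⊕ P) ℝ, (∀ x, 0 ≤ x ⬝ᵥ (Z *ᵥ x)) ∧
    (∀ x, x ⬝ᵥ (shiftedLap b *ᵥ x) ≤ x ⬝ᵥ (Z *ᵥ x)) ∧ Z.trace ≤ ∑ j, ∑ i, b j i

theorem isUnit_gram (X : Matrix P Q ℝ) : IsUnit ((graphMatrix X)ᵀ * graphMatrix X) := by
  rw [← mulVec_injective_iff_isUnit]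
  change Function.Injective ((graphMatrix X)ᵀ * graphMatrix X).mulVecLin
  rw [injective_iff_map_eq_zero]
  intro z hz
  rw [mulVecLin_apply, ← mulVec_mulVec] at hz
  have h0 : graphMatrix X *ᵥ z = 0 := by
    apply dotProduct_self_eq_zero.1
    rw [mulVec_dotProduct, hz, dotProduct_zero]
  rw [graphMatrix_mulVec] at h0
  ext j
  exact congrFun h0 (Sum.inl j)

/-- The compression of `H` to an invariant graph. -/
theorem IsNonnegGraph.exists_majorant {H : Matrix (Q ⊕ P) (Q ⊕ P) ℝ} (hH : H.IsSymm)
    {X : Matrix P Q ℝ} (hX : IsNonnegGraph H X)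
    (hc : ∀ w, (graphMatrix X)ᵀ *ᵥ w = 0 → w ⬝ᵥ (H *ᵥ w) ≤ 0) :
    ∃ Z : Matrix (Q ⊕ P) (Q ⊕ P) ℝ, (∀ x, 0 ≤ x ⬝ᵥ (Z *ᵥ x)) ∧
      (∀ x, x ⬝ᵥ (H *ᵥ x) ≤ x ⬝ᵥ (Z *ᵥ x)) ∧ Z.trace = (H * graphMatrix X).toRows₁.trace := by
  have hu := isUnit_gram X
  have hi := hX.invariant
  have hn := hX.nonneg
  generalize graphMatrix X = U at *
  set K := (H * U).toRows₁
  set G := Uᵀ * U with hG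
  have hGi : G * G⁻¹ = 1 := mul_nonsing_inv G ((isUnit_iff_isUnit_det G).1 hu)
  have hGi' : G⁻¹ * G = 1 := nonsing_inv_mul G ((isUnit_iff_isUnit_det G).1 hu)
  -- This is H composed with the orthogonal projection `U * G⁻¹ * Uᵀ`; by invariance H splits along
  -- the graph and its complement, where it is nonpositive.
  let Z := U * K * (G⁻¹ * Uᵀ)
  have hZ : ∀ x, Z *ᵥ x = H *ᵥ (U *ᵥ (G⁻¹ *ᵥ (Uᵀ *ᵥ x))) := by
    intro x
    change (U * K * (G⁻¹ * Uᵀ)) *ᵥ x = _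
    rw [← hi, ← mulVec_mulVec, ← mulVec_mulVec, ← mulVec_mulVec]
  have horth : ∀ x, Uᵀ *ᵥ (x - U *ᵥ (G⁻¹ *ᵥ (Uᵀ *ᵥ x))) = 0 := by
    intro x
    rw [mulVec_sub, mulVec_mulVec _ Uᵀ U, ← hG, mulVec_mulVec _ G, hGi, one_mulVec, sub_self]
  have hform : ∀ x, x ⬝ᵥ (Z *ᵥ x) = (U *ᵥ (G⁻¹ *ᵥ (Uᵀ *ᵥ x))) ⬝ᵥ
      (H *ᵥ (U *ᵥ (G⁻¹ *ᵥ (Uᵀ *ᵥ x)))) := by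
    intro x
    rw [hZ, ← sub_eq_zero, ← sub_dotProduct, mulVec_mulVec _ H U, hi, ← mulVec_mulVec,
      dotProduct_comm, mulVec_dotProduct, horth, dotProduct_zero]
  refine ⟨Z, fun x => ?_, fun x => ?_, ?_⟩
  · rw [hform]; exact hn _
  · rw [hform]
    have hox := horth x
    set a := U *ᵥ (G⁻¹ *ᵥ (Uᵀ *ᵥ x)) with ha
    have h1 := hc _ hox
    have h2 : (x - a) ⬝ᵥ (H *ᵥ a) = 0 := by
      rw [ha, mulVec_mulVec _ H U, hi, ← mulVec_mulVec, dotProduct_comm, mulVec_dotProduct,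
        ← ha, hox, dotProduct_zero]
    have h3 : a ⬝ᵥ (H *ᵥ (x - a)) = 0 := by
      rw [dotProduct_comm, mulVec_dotProduct, hH.eq, h2]
    have h4 : x ⬝ᵥ (H *ᵥ x) = (x - a) ⬝ᵥ (H *ᵥ (x - a)) + (x - a) ⬝ᵥ (H *ᵥ a) +
        a ⬝ᵥ (H *ᵥ (x - a)) + a ⬝ᵥ (H *ᵥ a) := by
      simp only [mulVec_sub, dotProduct_sub, sub_dotProduct]; ring
    linarith
  · change (U * K * (G⁻¹ * Uᵀ)).trace = _
    rw [Matrix.mul_assoc, trace_mul_comm, Matrix.mul_assoc K, Matrix.mul_assoc G⁻¹, ← hG, hGi',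
      Matrix.mul_one]

theorem hasMajorant_of_graph [Nonempty Q] [Nonempty P] {b : Matrix Q P ℝ}
    (hb : ∀ j i, 0 < b j i) (hb1 : ∀ j i, b j i < 1) (X₀ : Matrix P Q ℝ)
    (hX₀ : ∀ u, 0 ≤ (graphMatrix X₀ *ᵥ u) ⬝ᵥ (shiftedLap b *ᵥ (graphMatrix X₀ *ᵥ u))) :
    HasMajorant b := by
  obtain ⟨X, hX, -, hc⟩ := exists_unique_nonnegGraph (isSymm_shiftedLap b)
    (shiftedLap_neg hb1) X₀ hX₀
  obtain ⟨Z, h1, h2, h3⟩ := hX.exists_majorant (isSymm_shiftedLap b) hc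
  refine ⟨Z, h1, h2, ?_⟩
  rw [h3, trace]
  simp only [diag_apply, toRows₁_apply, shiftedLap_mul_graphMatrix_inl, if_true]
  refine Finset.sum_le_sum fun j _ => ?_
  have : ∑ i, X i j ≤ ∑ m, b j m * X m j :=
    Finset.sum_le_sum fun m _ => by nlinarith [hX.nonpos hb hb1 m j, hb1 j m]
  rw [hX.sum_col] at this
  linarith

/-- The complementary weights, with the roles of clique and independent set exchanged. -/
def complWeights (b : Matrix Q P ℝ) : Matrix P Q ℝ := of fun i j => 1 - b j i

/-- The two split graphs are complementary, so their Laplacians add up to N·1 - J with N = |Q| + |P|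
and J the all-ones matrix; the shifts |Q| and |P| remove N·1. -/
theorem shiftedLap_form_add_compl (b : Matrix Q P ℝ) (x : Q ⊕ P → ℝ) :
    x ⬝ᵥ (shiftedLap b *ᵥ x) +
      (x ∘ Sum.swap) ⬝ᵥ (shiftedLap (complWeights b) *ᵥ (x ∘ Sum.swap)) = -(∑ t, x t) ^ 2 := by
  obtain ⟨y, z, rfl⟩ : ∃ y z, x = Sum.elim y z := ⟨_, _, (Sum.elim_comp_inl_inr x).symm⟩
  have : Sum.elim y z ∘ Sum.swap = Sum.elim z y := by
    ext t; rcases t with i | j <;> rfl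
  rw [this, shiftedLap_form, shiftedLap_form, Fintype.sum_sum_type]
  simp only [Sum.elim_inl, Sum.elim_inr]
  have e1 : ∑ i, ∑ j, complWeights b i j * (z i - y j) ^ 2 =
      ∑ j, ∑ i, (y j - z i) ^ 2 - ∑ j, ∑ i, b j i * (y j - z i) ^ 2 := by
    rw [Finset.sum_comm, ← Finset.sum_sub_distrib]
    refine Finset.sum_congr rfl fun j _ => ?_
    rw [← Finset.sum_sub_distrib]
    refine Finset.sum_congr rfl fun i _ => ?_
    simp only [complWeights, of_apply]
    ring
  have e2 : ∑ j, ∑ i, (y j - z i) ^ 2 = Fintype.card P * ∑ j, y j ^ 2 -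
      2 * (∑ j, y j) * (∑ i, z i) + Fintype.card Q * ∑ i, z i ^ 2 := by
    have : ∀ j, ∑ i, (y j - z i) ^ 2 = Fintype.card P * y j ^ 2 - 2 * y j * (∑ i, z i) +
        ∑ i, z i ^ 2 := by
      intro j
      simp only [sub_sq, Finset.sum_add_distrib, Finset.sum_sub_distrib, Finset.sum_const,
        Finset.card_univ, nsmul_eq_mul, ← Finset.mul_sum]
    simp only [this, Finset.sum_add_distrib, Finset.sum_sub_distrib, Finset.sum_const,
      Finset.card_univ, nsmul_eq_mul, ← Finset.mul_sum, ← Finset.sum_mul]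
  rw [e1, e2]; ring

theorem trace_shiftedLap (b : Matrix Q P ℝ) :
    (shiftedLap b).trace = 2 * ∑ j, ∑ i, b j i - Fintype.card Q -
      Fintype.card P * Fintype.card Q := by
  have : ∑ i, ∑ j, b j i = ∑ j, ∑ i, b j i := Finset.sum_comm
  simp [shiftedLap, trace, Finset.sum_sub_distrib, this]
  ring

/-- On vectors of sum zero the two shifted forms are opposite, so adding the complementary majorant
to H gives a form that is nonnegative and dominates H. Compressing by the projection `R` off the
constants keeps this, since H is negative on constants. -/
theorem HasMajorant.of_compl [Nonempty Q] {b : Matrix Q P ℝ}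
    (h : HasMajorant (complWeights b)) : HasMajorant b := by
  obtain ⟨Z', h1, h2, h3⟩ := h
  let N : ℝ := Fintype.card (Q ⊕ P)
  have hN : 0 < N := by
    have : 0 < Fintype.card (Q ⊕ P) := Fintype.card_pos
    simp only [N]
    exact_mod_cast this
  let Zc : Matrix (Q ⊕ P) (Q ⊕ P) ℝ := Z'.submatrix (Equiv.sumComm Q P) (Equiv.sumComm Q P)
  have hZc : ∀ x, x ⬝ᵥ (Zc *ᵥ x) = (x ∘ Sum.swap) ⬝ᵥ (Z' *ᵥ (x ∘ Sum.swap)) := by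
    intro x
    change x ⬝ᵥ (Z'.submatrix (Equiv.sumComm Q P) (Equiv.sumComm Q P) *ᵥ x) = _
    rw [submatrix_mulVec_equiv, ← comp_equiv_symm_dotProduct]
    rfl
  have hZctr : Zc.trace = Z'.trace := 
    (Equiv.sumComm Q P).sum_comp fun t => Z' t t
  let J : Matrix (Q ⊕ P) (Q ⊕ P) ℝ := of fun _ _ => 1
  let R : Matrix (Q ⊕ P) (Q ⊕ P) ℝ := 1 - N⁻¹ • J
  have hJx : ∀ x : Q ⊕ P → ℝ, J *ᵥ x = (∑ t, x t) • 1 := by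
    intro x; ext s; simp [J, mulVec, dotProduct]
  have hRx : ∀ x : Q ⊕ P → ℝ, R *ᵥ x = x - (N⁻¹ * ∑ t, x t) • 1 := by
    intro x
    rw [sub_mulVec, one_mulVec, smul_mulVec, hJx, smul_smul]
  have hRsum : ∀ x : Q ⊕ P → ℝ, ∑ t, (R *ᵥ x) t = 0 := by
    intro x
    rw [hRx]
    simp only [Pi.sub_apply, Pi.smul_apply, Pi.one_apply, smul_eq_mul, mul_one,
      Finset.sum_sub_distrib, Finset.sum_const, Finset.card_univ, nsmul_eq_mul]
    change _ - N * _ = 0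
    field_simp
    ring
  have hRt : Rᵀ = R := by
    have : Jᵀ = J := rfl
    rw [transpose_sub, transpose_one, transpose_smul, this]
  have hRR : R * R = R := by
    apply ext_of_mulVec_single
    intro t
    rw [← mulVec_mulVec, hRx (R *ᵥ _), hRsum]
    simp
  set A := shiftedLap b + Zc with hA
  have hform : ∀ x, x ⬝ᵥ ((R * A * R) *ᵥ x) = (R *ᵥ x) ⬝ᵥ (A *ᵥ (R *ᵥ x)) := by
    intro x
    rw [← mulVec_mulVec, ← mulVec_mulVec, mulVec_dotProduct, hRt]
  have hsplit : ∀ x, x ⬝ᵥ (A *ᵥ x) = x ⬝ᵥ (shiftedLap b *ᵥ x) + x ⬝ᵥ (Zc *ᵥ x) := by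
    intro x; rw [hA, add_mulVec, dotProduct_add]
  refine ⟨R * A * R, fun x => ?_, fun x => ?_, ?_⟩
  · rw [hform, hsplit, hZc]
    have e := shiftedLap_form_add_compl b (R *ᵥ x)
    rw [hRsum] at e
    have := h2 ((R *ᵥ x) ∘ Sum.swap)
    linarith
  · rw [hform, hsplit, hZc]
    have e0 := h1 ((R *ᵥ x) ∘ Sum.swap)
    set a := N⁻¹ * ∑ t, x t
    have hx : x = R *ᵥ x + a • 1 := by rw [hRx]; simp [a]
    have e1 : shiftedLap b *ᵥ x = shiftedLap b *ᵥ (R *ᵥ x) + (-(a * Fintype.card Q)) • 1 := by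
      conv_lhs => rw [hx]
      rw [mulVec_add, mulVec_smul, shiftedLap_mulVec_one, smul_smul]
      congr 2; ring
    have e2 : (R *ᵥ x) ⬝ᵥ (1 : Q ⊕ P → ℝ) = 0 := by rw [dotProduct_one, hRsum]
    have e3 : (1 : Q ⊕ P → ℝ) ⬝ᵥ (shiftedLap b *ᵥ (R *ᵥ x)) = 0 := by
      rw [dotProduct_comm, mulVec_dotProduct, (isSymm_shiftedLap b).eq, shiftedLap_mulVec_one,
        dotProduct_smul, e2, smul_zero]
    have e4 : (1 : Q ⊕ P → ℝ) ⬝ᵥ (1 : Q ⊕ P → ℝ) = N := by simp [N]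
    have e5 : x ⬝ᵥ (shiftedLap b *ᵥ x) = (R *ᵥ x) ⬝ᵥ (shiftedLap b *ᵥ (R *ᵥ x)) -
        a ^ 2 * Fintype.card Q * N := by
      rw [e1]
      conv_lhs => enter [1]; rw [hx]
      rw [dotProduct_add, add_dotProduct, add_dotProduct, dotProduct_smul, dotProduct_smul,
        smul_dotProduct, smul_dotProduct, e2, e3, e4]
      simp only [smul_eq_mul]; ring
    have : 0 ≤ a ^ 2 * Fintype.card Q * N := by positivity
    linarith
  · have hJtr : ∀ B : Matrix (Q ⊕ P) (Q ⊕ P) ℝ, (B * J).trace = 1 ⬝ᵥ (B *ᵥ 1) := by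
      intro B
      simp [J, trace, mul_apply, mulVec, dotProduct]
    have ht : (R * A * R).trace = A.trace - N⁻¹ * (1 ⬝ᵥ (A *ᵥ 1)) := by
      rw [trace_mul_comm, ← Matrix.mul_assoc, hRR, trace_mul_comm]
      change (A * (1 - N⁻¹ • J)).trace = _
      rw [Matrix.mul_sub, Matrix.mul_one, trace_sub, Matrix.mul_smul, trace_smul, hJtr,
        smul_eq_mul]
    have e0 : 0 ≤ (1 : Q ⊕ P → ℝ) ⬝ᵥ (Zc *ᵥ 1) := by rw [hZc]; exact h1 _
    have e1 : (1 : Q ⊕ P → ℝ) ⬝ᵥ (shiftedLap b *ᵥ 1) = -(Fintype.card Q * N) := by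
      rw [shiftedLap_mulVec_one]; simp [N]
    have e2 : ∑ i, ∑ j, complWeights b i j = Fintype.card P * Fintype.card Q -
        ∑ j, ∑ i, b j i := by
      rw [Finset.sum_comm (f := fun j i => b j i)]
      simp [complWeights, Finset.sum_sub_distrib]
    rw [e2] at h3
    rw [ht, hsplit, e1, hA, trace_add, trace_shiftedLap, hZctr]
    have e3 : N⁻¹ * (-(Fintype.card Q * N) + 1 ⬝ᵥ (Zc *ᵥ 1)) =
        -Fintype.card Q + N⁻¹ * 1 ⬝ᵥ (Zc *ᵥ 1) := by
      field_simp
    have e4 : 0 ≤ N⁻¹ * 1 ⬝ᵥ (Zc *ᵥ 1) := mul_nonneg (inv_nonneg.2 hN.le) e0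
    linarith

/-- Either H has at least |Q| nonnegative eigenvalues, or the complementary form has a nonnegative
subspace of dimension at least |P|. -/
theorem hasMajorant [Nonempty Q] [Nonempty P] {b : Matrix Q P ℝ}
    (hb : ∀ j i, 0 < b j i) (hb1 : ∀ j i, b j i < 1) : HasMajorant b := by
  obtain ⟨V, l, h1, h2, hV⟩ := (isSymm_shiftedLap b).exists_diagonalization
  have hform := form_eq_coords h2 h1 hV
  have hcompl : Fintype.card {i // l i < 0} + Fintype.card {i // ¬ l i < 0} =
      Fintype.card Q + Fintype.card P := by
    rw [Fintype.card_subtype_compl, ← Fintype.card_sum]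
    exact Nat.add_sub_cancel' (Fintype.card_subtype_le _)
  by_cases hq : Fintype.card Q ≤ Fintype.card {i // ¬ l i < 0}
  · let F : (Q ⊕ P → ℝ) →ₗ[ℝ] ({i // l i < 0} → ℝ) :=
      (LinearMap.funLeft ℝ ℝ Subtype.val).comp Vᵀ.mulVecLin
    have hpos : ∀ w ∈ LinearMap.ker F, 0 ≤ w ⬝ᵥ (shiftedLap b *ᵥ w) := by
      intro w hw
      rw [hform]
      refine Finset.sum_nonneg fun i _ => ?_
      by_cases hi : l i < 0
      · have : (Vᵀ *ᵥ w) i = 0 := congrFun (LinearMap.mem_ker.1 hw) ⟨i, hi⟩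
        rw [this]; simp
      · exact mul_nonneg (not_lt.1 hi) (sq_nonneg _)
    have hrank : Fintype.card Q ≤ Module.finrank ℝ (LinearMap.ker F) := by
      have a := LinearMap.finrank_range_add_finrank_ker F
      have b := Submodule.finrank_le (LinearMap.range F)
      simp only [Module.finrank_fintype_fun_eq_card, Fintype.card_sum] at a b
      omega
    obtain ⟨X, hX⟩ := exists_graph_of_subspace (shiftedLap_neg hb1) _ hrank hpos
    exact hasMajorant_of_graph hb hb1 X fun u => hpos _ (hX u)
  · apply HasMajorant.of_compl
    let F : (Q ⊕ P → ℝ) →ₗ[ℝ] ({i // ¬ l i < 0} → ℝ) × ℝ :=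
      ((LinearMap.funLeft ℝ ℝ Subtype.val).comp Vᵀ.mulVecLin).prod (∑ t, LinearMap.proj t)
    let F' : (P ⊕ Q → ℝ) →ₗ[ℝ] ({i // ¬ l i < 0} → ℝ) × ℝ := F.comp (LinearMap.funLeft ℝ ℝ Sum.swap)
    have hpos : ∀ w ∈ LinearMap.ker F', 0 ≤ w ⬝ᵥ (shiftedLap (complWeights b) *ᵥ w) := by
      intro w hw
      have hw' := LinearMap.mem_ker.1 hw
      have hs : ∑ t, (w ∘ Sum.swap) t = 0 := by
        simpa [F', F, LinearMap.funLeft] using congrArg Prod.snd hw'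
      have e := shiftedLap_form_add_compl b (w ∘ Sum.swap)
      have hww : (w ∘ Sum.swap) ∘ Sum.swap = w := by
        ext t; rcases t with i | j <;> rfl
      rw [hs, hww, hform] at e
      have : ∑ i, l i * (Vᵀ *ᵥ (w ∘ Sum.swap)) i ^ 2 ≤ 0 := by
        refine Finset.sum_nonpos fun i _ => ?_
        by_cases hi : l i < 0
        · exact mul_nonpos_of_nonpos_of_nonneg hi.le (sq_nonneg _)
        · have : (Vᵀ *ᵥ (w ∘ Sum.swap)) i = 0 := congrFun (congrArg Prod.fst hw') ⟨i, hi⟩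
          rw [this]; simp
      linarith
    -- At most |Q| - 1 eigenvalues are nonnegative here, which pays for the one extra condition that
    -- the sum vanish.
    have hrank : Fintype.card P ≤ Module.finrank ℝ (LinearMap.ker F') := by
      have a := LinearMap.finrank_range_add_finrank_ker F'
      have b := Submodule.finrank_le (LinearMap.range F')
      simp only [Module.finrank_fintype_fun_eq_card, Fintype.card_sum, Module.finrank_prod,
        Module.finrank_self] at a b
      omega
    have hc0 : ∀ i j, 0 < complWeights b i j := fun i j => sub_pos.2 (hb1 j i)
    have hc1 : ∀ i j, complWeights b i j < 1 := fun i j => sub_lt_self _ (hb j i)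
    obtain ⟨X, hX⟩ := exists_graph_of_subspace (shiftedLap_neg hc1) _ hrank hpos
    exact hasMajorant_of_graph hc0 hc1 X fun u => hpos _ (hX u)

/-- For an orthogonal matrix `W`, the Laplacian form summed over columns of `W`. -/
theorem sum_shiftedLap_form_le [Nonempty Q] [Nonempty P] {b : Matrix Q P ℝ}
    (hb : ∀ j i, 0 ≤ b j i) (hb1 : ∀ j i, b j i ≤ 1) {ι : Type*} [Fintype ι] [DecidableEq ι]
    (W : Matrix (Q ⊕ P) ι ℝ) (hW : W * Wᵀ = 1) (s : Finset ι) :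
    ∑ a ∈ s, W.col a ⬝ᵥ (shiftedLap b *ᵥ W.col a) ≤ ∑ j, ∑ i, b j i := by
  -- Mixing in 1/2 makes the weights lie strictly between 0 and 1; the inequality passes to t = 0 by
  -- continuity.
  let c : ℝ → Matrix Q P ℝ := fun t => of fun j i => (1 - t) * b j i + t * (1 / 2)
  have hc : Continuous c := continuous_matrix fun j i => by
    change Continuous fun t : ℝ => (1 - t) * b j i + t * (1 / 2)
    fun_prop
  have hc0 : c 0 = b := by ext; simp [c]
  have key : ∀ t ∈ Set.Ioo (0 : ℝ) 1,
      ∑ a ∈ s, W.col a ⬝ᵥ (shiftedLap (c t) *ᵥ W.col a) ≤ ∑ j, ∑ i, c t j i := by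
    intro t ht
    obtain ⟨Z, h1, h2, h3⟩ := hasMajorant (b := c t)
      (fun j i => by simp only [c, of_apply]; nlinarith [hb j i, ht.1, ht.2])
      (fun j i => by simp only [c, of_apply]; nlinarith [hb1 j i, ht.1, ht.2])
    calc _ ≤ ∑ a ∈ s, W.col a ⬝ᵥ (Z *ᵥ W.col a) := Finset.sum_le_sum fun a _ => h2 _
      _ ≤ ∑ a, W.col a ⬝ᵥ (Z *ᵥ W.col a) := Finset.sum_le_sum_of_subset_of_nonneg
          (Finset.subset_univ _) fun a _ _ => h1 _
      _ = (Wᵀ * (Z * W)).trace := rfl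
      _ = Z.trace := by rw [trace_mul_comm, Matrix.mul_assoc, hW, Matrix.mul_one]
      _ ≤ _ := h3
  have hl : Continuous fun t => ∑ a ∈ s, W.col a ⬝ᵥ (shiftedLap (c t) *ᵥ W.col a) :=
    continuous_finsetSum _ fun a _ => continuous_const.dotProduct
      ((continuous_shiftedLap.comp hc).matrix_mulVec continuous_const)
  have hr : Continuous fun t => ∑ j, ∑ i, c t j i :=
    continuous_finsetSum _ fun j _ => continuous_finsetSum _ fun i _ => hc.matrix_elem j i
  have h0 : (0 : ℝ) ∈ closure (Set.Ioo (0 : ℝ) 1) := by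
    rw [closure_Ioo zero_ne_one]; exact ⟨le_rfl, zero_le_one⟩
  have := le_on_closure key hl.continuousOn hr.continuousOn h0
  rwa [hc0] at this

end SplitLaplacian
-- Bounds on Laplacian eigenvalue sums of a graph.
namespace SimpleGraph

variable {V : Type*} [Fintype V] [DecidableEq V] (G : SimpleGraph V) [DecidableRel G.Adj]

theorem lapMatrix_form (x : V → ℝ) :
    x ⬝ᵥ (G.lapMatrix ℝ *ᵥ x) = (∑ i, ∑ j, if G.Adj i j then (x i - x j) ^ 2 else 0) / 2 := by
  rw [← toLinearMap₂'_apply', lapMatrix_toLinearMap₂']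

theorem sum_sum_sq_sub {ι : Type*} [Fintype ι] (x : ι → ℝ) :
    ∑ i, ∑ j, (x i - x j) ^ 2 = 2 * (Fintype.card ι * ∑ i, x i ^ 2 - (∑ i, x i) ^ 2) := by
  have : ∀ i, ∑ j, (x i - x j) ^ 2 =
      Fintype.card ι * x i ^ 2 - 2 * x i * ∑ j, x j + ∑ j, x j ^ 2 := by
    intro i
    simp only [sub_sq, Finset.sum_add_distrib, Finset.sum_sub_distrib, Finset.sum_const,
      Finset.card_univ, nsmul_eq_mul, ← Finset.mul_sum]
  simp only [this, Finset.sum_add_distrib, Finset.sum_sub_distrib, Finset.sum_const,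
    Finset.card_univ, nsmul_eq_mul, ← Finset.mul_sum, ← Finset.sum_mul]
  ring

theorem half_sum_adj_le {ι : Type*} [Fintype ι] (R : ι → ι → Prop) [DecidableRel R] (x : ι → ℝ) :
    (∑ i, ∑ j, if R i j then (x i - x j) ^ 2 else 0) / 2 ≤
      Fintype.card ι * ∑ i, x i ^ 2 - (∑ i, x i) ^ 2 := by
  have : ∑ i, ∑ j, (if R i j then (x i - x j) ^ 2 else 0) ≤ ∑ i, ∑ j, (x i - x j) ^ 2 := by
    refine Finset.sum_le_sum fun i _ => Finset.sum_le_sum fun j _ => ?_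
    split_ifs
    · exact le_rfl
    · positivity
  rw [sum_sum_sq_sub] at this
  linarith

theorem exists_laplacianSum_eq {k : ℕ} (hk : k ≤ Fintype.card V) :
    ∃ (W : Matrix V V ℝ) (s : Finset V), W * Wᵀ = 1 ∧ Wᵀ * W = 1 ∧ s.card = k ∧
      G.laplacianSum k = ∑ a ∈ s, W.col a ⬝ᵥ (G.lapMatrix ℝ *ᵥ W.col a) := by
  have hL := G.isHermitian_lapMatrix ℝ
  -- The same equivalence by which `eigenvalues` is obtained from `eigenvalues₀`, so column `e i`
  -- belongs to the i-th largest eigenvalue.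
  let e : Fin (Fintype.card V) ≃ V := Fintype.equivOfCardEq (Fintype.card_fin _)
  have h1 : (hL.eigenvectorUnitary : Matrix V V ℝ) * (hL.eigenvectorUnitary : Matrix V V ℝ)ᵀ = 1 := by
    have := Unitary.coe_mul_star_self hL.eigenvectorUnitary
    rwa [Unitary.coe_star, star_eq_conjTranspose, conjTranspose_eq_transpose_of_trivial] at this
  have h2 : (hL.eigenvectorUnitary : Matrix V V ℝ)ᵀ * (hL.eigenvectorUnitary : Matrix V V ℝ) = 1 := by
    have := Unitary.coe_star_mul_self hL.eigenvectorUnitary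
    rwa [star_eq_conjTranspose, conjTranspose_eq_transpose_of_trivial] at this
  refine ⟨hL.eigenvectorUnitary, (Finset.univ.filter fun i => i.val < k).map e.toEmbedding,
    h1, h2, ?_, ?_⟩
  · rw [Finset.card_map, Fin.card_filter_val_lt, min_eq_right hk]
  · rw [Finset.sum_map, laplacianSum]
    refine Finset.sum_congr rfl fun i _ => ?_
    have hv : (hL.eigenvectorUnitary : Matrix V V ℝ).col (e i) ⬝ᵥ
        (hL.eigenvectorUnitary : Matrix V V ℝ).col (e i) = 1 := by
      have := congrFun (congrFun h2 (e i)) (e i)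
      rwa [one_apply_eq] at this
    change _ = (hL.eigenvectorUnitary : Matrix V V ℝ).col (e i) ⬝ᵥ
      (G.lapMatrix ℝ *ᵥ (hL.eigenvectorBasis (e i)))
    rw [hL.mulVec_eigenvectorBasis, dotProduct_smul, ← hL.eigenvectorUnitary_col_eq, hv,
      smul_eq_mul, mul_one, IsHermitian.eigenvalues]
    exact congrArg _ (e.symm_apply_apply i).symm

theorem laplacianSum_le_mul_card {k : ℕ} (hk : k ≤ Fintype.card V) :
    G.laplacianSum k ≤ k * Fintype.card V := by
  obtain ⟨W, s, -, h2, hs, h⟩ := G.exists_laplacianSum_eq hk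
  rw [h, ← hs, ← nsmul_eq_mul]
  refine Finset.sum_le_card_nsmul _ _ _ fun a _ => ?_
  have hv : W.col a ⬝ᵥ W.col a = 1 := by
    have := congrFun (congrFun h2 a) a
    rwa [one_apply_eq] at this
  have hv' : ∑ i, W.col a i ^ 2 = 1 := by
    rw [← hv]; exact Finset.sum_congr rfl fun i _ => sq _
  rw [lapMatrix_form]
  have := half_sum_adj_le G.Adj (W.col a)
  rw [hv'] at this
  nlinarith [sq_nonneg (∑ i, W.col a i)]

/-- Completing the complement of S to a clique costs k times its size through the shift. The cross
edges and twice the edges inside S together make up the degree sum over S. -/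
theorem laplacianSum_le_of_partition (S : V → Prop) [DecidablePred S] (hS : ∃ v, S v) {k : ℕ}
    (hk : k ≤ Fintype.card V) :
    G.laplacianSum k ≤ k * Fintype.card {v // ¬ S v} + ∑ v : {v // S v}, (G.degree v : ℝ) := by
  obtain ⟨W, s, h1, h2, hs, h⟩ := G.exists_laplacianSum_eq hk
  let e : {v // ¬ S v} ⊕ {v // S v} ≃ V := (Equiv.sumComm _ _).trans (Equiv.sumCompl S)
  let G' : SimpleGraph {v // S v} := G.comap Subtype.val
  let b : Matrix {v // ¬ S v} {v // S v} ℝ := of fun j i => if G.Adj j i then 1 else 0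
  let q : ℝ := Fintype.card {v // ¬ S v}
  have hsum : ∀ f : V → ℝ, ∑ v, f v = ∑ j : {v // ¬ S v}, f j + ∑ i : {v // S v}, f i := by
    intro f
    rw [← e.sum_comp, Fintype.sum_sum_type]
    rfl
  have hform : ∀ x : V → ℝ, x ⬝ᵥ (G.lapMatrix ℝ *ᵥ x) ≤
      (x ∘ e) ⬝ᵥ (SplitLaplacian.shiftedLap b *ᵥ (x ∘ e)) + q * ∑ v, x v ^ 2 +
        (x ∘ Subtype.val) ⬝ᵥ (G'.lapMatrix ℝ *ᵥ (x ∘ Subtype.val)) := by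
    intro x
    have hxe : x ∘ e = Sum.elim (fun j : {v // ¬ S v} => x j) (fun i : {v // S v} => x i) := by
      ext t; rcases t with j | i <;> rfl
    have hcl := half_sum_adj_le (fun j l : {v // ¬ S v} => G.Adj j l)
      (fun j : {v // ¬ S v} => x j)
    rw [hxe, SplitLaplacian.shiftedLap_form, lapMatrix_form, lapMatrix_form, hsum fun v => x v ^ 2]
    simp only [hsum, Finset.sum_add_distrib]
    have e1 : ∑ j : {v // ¬ S v}, ∑ i : {v // S v}, b j i * (x j - x i) ^ 2 =
        ∑ j : {v // ¬ S v}, ∑ i : {v // S v}, if G.Adj j i then (x j - x i) ^ 2 else 0 := by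
      refine Finset.sum_congr rfl fun j _ => Finset.sum_congr rfl fun i _ => ?_
      simp [b]
    have e2 : ∑ i : {v // S v}, ∑ j : {v // ¬ S v}, (if G.Adj i j then (x i - x j) ^ 2 else 0) =
        ∑ j : {v // ¬ S v}, ∑ i : {v // S v}, if G.Adj j i then (x j - x i) ^ 2 else 0 := by
      rw [Finset.sum_comm]
      refine Finset.sum_congr rfl fun j _ => Finset.sum_congr rfl fun i _ => ?_
      rw [if_congr (G.adj_comm i j) rfl rfl, ← neg_sub (x i), neg_sq]
    have e3 : ∑ i : {v // S v}, ∑ l : {v // S v},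
        (if G'.Adj i l then ((x ∘ Subtype.val) i - (x ∘ Subtype.val) l) ^ 2 else 0) =
        ∑ i : {v // S v}, ∑ l : {v // S v}, if G.Adj i l then (x i - x l) ^ 2 else 0 := rfl
    rw [e1, e2, e3]
    linarith
  have hQ : ∑ a ∈ s, (W.col a ∘ e) ⬝ᵥ (SplitLaplacian.shiftedLap b *ᵥ (W.col a ∘ e)) ≤
      ∑ j, ∑ i, b j i := by
    obtain ⟨v, hv⟩ := hS
    have : Nonempty {v // S v} := ⟨⟨v, hv⟩⟩
    rcases isEmpty_or_nonempty {v // ¬ S v} with hE | hE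
    · rw [Finset.univ_eq_empty, Finset.sum_empty]
      refine Finset.sum_nonpos fun a _ => ?_
      rw [← Sum.elim_comp_inl_inr (W.col a ∘ e), SplitLaplacian.shiftedLap_form]
      simp
    · refine SplitLaplacian.sum_shiftedLap_form_le ?_ ?_ (W.submatrix e id) ?_ s
      · intro j i; simp only [b, of_apply]; split_ifs <;> norm_num
      · intro j i; simp only [b, of_apply]; split_ifs <;> norm_num
      · ext t t'
        have := congrFun (congrFun h1 (e t)) (e t')
        simpa [mul_apply, one_apply] using this
  have hP : ∑ a ∈ s, (W.col a ∘ Subtype.val) ⬝ᵥ (G'.lapMatrix ℝ *ᵥ (W.col a ∘ Subtype.val)) ≤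
      ∑ i, (G'.degree i : ℝ) := by
    -- The inner form is nonnegative, so its sum over `s` is at most its sum over all columns, which
    -- is the trace because the rows of `R` are orthonormal.
    let R : Matrix {v // S v} V ℝ := W.submatrix Subtype.val id
    have hR : R * Rᵀ = 1 := by
      ext t t'
      have := congrFun (congrFun h1 t) t'
      simpa [R, mul_apply, one_apply, Subtype.ext_iff] using this
    calc _ ≤ ∑ a, (W.col a ∘ Subtype.val) ⬝ᵥ (G'.lapMatrix ℝ *ᵥ (W.col a ∘ Subtype.val)) := by
          refine Finset.sum_le_sum_of_subset_of_nonneg (Finset.subset_univ _) fun a _ _ => ?_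
          rw [lapMatrix_form]
          positivity
      _ = (Rᵀ * (G'.lapMatrix ℝ * R)).trace := rfl
      _ = (G'.lapMatrix ℝ).trace := by
          rw [trace_mul_comm, Matrix.mul_assoc, hR, Matrix.mul_one]
      _ = _ := by simp [trace, lapMatrix, degMatrix]
  have hdeg : ∑ j, ∑ i, b j i + ∑ i, (G'.degree i : ℝ) = ∑ v : {v // S v}, (G.degree v : ℝ) := by
    have hb : ∑ j, ∑ i, b j i = ∑ i, ∑ j, b j i := Finset.sum_comm
    rw [hb, ← Finset.sum_add_distrib]
    refine Finset.sum_congr rfl fun i _ => ?_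
    rw [degree_eq_sum_if_adj, degree_eq_sum_if_adj, hsum]
    congr 1
    refine Finset.sum_congr rfl fun j _ => ?_
    simp only [b, of_apply, G.adj_comm]
  have hnorm : ∀ a, ∑ v, W.col a v ^ 2 = 1 := by
    intro a
    have := congrFun (congrFun h2 a) a
    rw [one_apply_eq] at this
    rw [← this]
    exact Finset.sum_congr rfl fun i _ => sq _
  calc G.laplacianSum k = ∑ a ∈ s, W.col a ⬝ᵥ (G.lapMatrix ℝ *ᵥ W.col a) := h
    _ ≤ _ := Finset.sum_le_sum fun a _ => hform _
    _ ≤ ∑ j, ∑ i, b j i + k * q + ∑ i, (G'.degree i : ℝ) := by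
        rw [Finset.sum_add_distrib, Finset.sum_add_distrib]
        simp only [hnorm, mul_one, Finset.sum_const, hs, nsmul_eq_mul]
        linarith
    _ = _ := by rw [← hdeg]; ring

/-- If `p ≥ 1` vertices have degree `r`, then `S_k ≤ k n - (k - r) p`. -/
theorem laplacianSum_le_of_card_degree_eq {r p : ℕ}
    (hp : (Finset.univ.filter fun v => G.degree v = r).card = p) (hp1 : 1 ≤ p) {k : ℕ}
    (hk : k ≤ Fintype.card V) :
    G.laplacianSum k ≤ k * Fintype.card V - ((k : ℝ) - r) * p := by
  have hex : ∃ v, G.degree v = r := by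
    obtain ⟨v, hv⟩ := Finset.card_pos.1 (hp ▸ hp1 : 0 < _)
    exact ⟨v, (Finset.mem_filter.1 hv).2⟩
  have h := G.laplacianSum_le_of_partition (fun v => G.degree v = r) hex hk
  have hcard : Fintype.card {v // G.degree v = r} = p := by
    rw [Fintype.card_subtype, hp]
  have hle : p ≤ Fintype.card V := hcard ▸ Fintype.card_subtype_le _
  have hd : ∑ v : {v // G.degree v = r}, (G.degree v : ℝ) = p * r := by
    have : ∀ v : {v // G.degree v = r}, (G.degree v : ℝ) = r := fun v => by rw [v.2]
    simp only [this, Finset.sum_const, Finset.card_univ, hcard, nsmul_eq_mul]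
  rw [hd, Fintype.card_subtype_compl, hcard, Nat.cast_sub hle] at h
  linarith

theorem brouwerHolds_iff (k : ℕ) :
    G.BrouwerHolds k ↔ G.laplacianSum k ≤ G.edgeFinset.card + (k : ℝ) * (k + 1) / 2 := by
  rw [BrouwerHolds, Nat.cast_choose_two, Nat.cast_add, Nat.cast_one, add_sub_cancel_right,
    mul_comm (k : ℝ)]

end SimpleGraph

/-! ### The three ranges of k. -/

theorem mainTheorem6 {V : Type*} [Fintype V] [DecidableEq V] (G : SimpleGraph V)
    [DecidableRel G.Adj] (hG : G.Connected) (n m p r : ℕ)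
    (hn : Fintype.card V = n) (hn4 : 4 ≤ n) (hm : G.edgeFinset.card = m)
    (hp : (Finset.univ.filter (fun v : V => G.degree v = r)).card = p) (hp1 : 1 ≤ p)
    (hr1 : 1 ≤ r) :
    ((m : ℝ) ≥ (2 * (n : ℝ) - r - 1) * r / 2 →
      ∀ k : ℕ, 1 ≤ k → k ≤ r → G.BrouwerHolds k) ∧
    ((p : ℝ) < (n : ℝ) / 2 →
      (m : ℝ) ≥ ((n : ℝ) - 1) * (3 * n - 1) / 8 - ((n : ℝ) - 1 - 2 * r) * p / 2 →
      ∀ k : ℕ, r + 1 ≤ k → (k : ℝ) ≤ ((n : ℝ) - 1) / 2 → G.BrouwerHolds k) ∧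
    ((p : ℝ) > (n : ℝ) / 2 →
      (m : ℝ) ≥ ((n : ℝ) - 1) * (3 * n - 1) / 8 - ((n : ℝ) - 1 - 2 * r) * p / 2 →
      ∀ k : ℕ, ((n : ℝ) - 1) / 2 ≤ (k : ℝ) → k ≤ n → G.BrouwerHolds k) := by
  have hn0 : (4 : ℝ) ≤ n := by exact_mod_cast hn4
  have bound : ∀ k : ℕ, k ≤ n → G.laplacianSum k ≤ k * n - ((k : ℝ) - r) * p := by
    intro k hk
    rw [← hn] at hk ⊢
    exact G.laplacianSum_le_of_card_degree_eq hp hp1 hk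
  refine ⟨fun h k _ hkr => ?_, fun hpn h k _ hkn => ?_, fun hpn h k hkn hk => ?_⟩
  · have hrn : r < n := by
      obtain ⟨v, hv⟩ := Finset.card_pos.1 (hp ▸ hp1 : 0 < _)
      rw [← (Finset.mem_filter.1 hv).2, ← hn]
      exact G.degree_lt_card_verts v
    rw [G.brouwerHolds_iff, hm]
    have hb := G.laplacianSum_le_mul_card (hn ▸ (hkr.trans hrn.le) : k ≤ Fintype.card V)
    rw [hn] at hb
    have h1 : (k : ℝ) ≤ r := by exact_mod_cast hkr
    have h2 : (r : ℝ) + 1 ≤ n := by exact_mod_cast hrn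
    -- With g(k) = kn - k(k+1)/2, the hypothesis says m ≥ g(r), and the product is 2(g(r) - g(k)).
    nlinarith [mul_nonneg (sub_nonneg.2 h1) (by linarith : (0 : ℝ) ≤ 2 * n - 1 - r - k)]
  · have hk : k ≤ n := by
      have : (k : ℝ) ≤ n := by linarith
      exact_mod_cast this
    rw [G.brouwerHolds_iff, hm]
    have hb := bound k hk
    -- With f(k) = kn - (k - r)p - k(k+1)/2, the threshold on m is exactly f((n-1)/2), and the
    -- product is 2(f((n-1)/2) - f(k)). The peak of f is at n - p - 1/2, to the right of (n-1)/2
    -- exactly when p < n/2.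
    nlinarith [mul_nonneg (sub_nonneg.2 hkn)
      (by linarith : (0 : ℝ) ≤ 2 * n - 1 - 2 * p - ((n - 1) / 2 + k))]
  · rw [G.brouwerHolds_iff, hm]
    have hb := bound k hk
    -- Both factors of the same difference change sign: k is now beyond (n-1)/2, and p > n/2 puts
    -- the peak of f before it.
    nlinarith [mul_nonneg (sub_nonneg.2 hkn)
      (by linarith : (0 : ℝ) ≤ ((n - 1) / 2 + k) - (2 * n - 1 - 2 * p))]
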